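/- Let $k,q\ge 1$ be integers. Let $W_{k,q}=\{\mathbf v\in\mathbb Z^{k-1}: 0\le v_1\le\dots\le v_{k-1}\le q\}$. For $\mathbf v\in W_{k,q}$ with $\mathbf v+(1,\dots,1)\in W_{k,q}$ and a permutation $\pi=\pi_1\cdots\pi_{k-1}$ of $\{1,\dots,k-1\}$ in which $i$ appears before $i+1$ whenever $v_i=v_{i+1}$, let $F(\mathbf v,\pi)=\{\mathbf v^{(1)},\dots,\mathbf v^{(k)}\}$, where $\mathbf v^{(1)}=\mathbf v$ and $\mathbf v^{(i+1)}=\mathbf v^{(i)}+e_{\pi_{k-i}}$ for $1\le i\le k-1$. The edgewise subdivision $T_{k,q}$ is the simplicial complex whose facets are the sets $F(\mathbf v,\pi)$. For $\mathbf a=(a_1,\dots,a_{k-1})\in\mathcal S_{k,q}=\{0,\dots,q-1\}^{k-1}$ let $\alpha$ be the permutation with $a_{\alpha_1}\le\dots\le a_{\alpha_{k-1}}$, where $\alpha_i<\alpha_{i+1}$ whenever $a_{\alpha_i}=a_{\alpha_{i+1}}$; put $\mathbf v_a=(a_{\alpha_1},\dots,a_{\alpha_{k-1}})$ and $F(\mathbf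 a)=F(\mathbf v_a,\alpha^{-1})=\{\mathbf v_a^{(1)},\dots,\mathbf v_a^{(k)}\}$. Put $a_0=0$, $m(\mathbf a)=\max_{1\le i\le k-1} a_i$ (and $m(\mathbf a)=0$ if $k=1$), $S(\mathbf a)=\sum_{i=1}^{k-1} a_i$, and let $F(\mathbf a)<F(\mathbf b)$ mean that $m(\mathbf a)<m(\mathbf b)$, or $m(\mathbf a)=m(\mathbf b)$ and $S(\mathbf a)<S(\mathbf b)$, or $m(\mathbf a)=m(\mathbf b)$, $S(\mathbf a)=S(\mathbf b)$ and there is an $i$ with $a_i>b_i$ and $a_j=b_j$ for all $j<i$. A linear order on the facets of a pure finite simplicial complex is a shelling order if for all facets $F<G$ there are a facet $H<G$ and a vertex $v\in G$ with $F\cap G\subseteq H\cap G=G\setminus\{v\}$; the restriction $\mathcal R(G)$ is the set of those vertices $v$ of $G$ for which $G\setminus\{v\}\subseteq F$ for some facet $F<G$. The $h$-vector of a $d$-dimensional complex with $f_{i}$ faces of dimension $i$ ($f_{-1}=1$) is $(h_0,\dots,h_{d+1})$ with $h_s=\sum_{i=0}^{s}(-1)^{s-i}\binom{d+1-i}{d+1-s}f_{i-1}$.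 Then: (1) $T_{k,q}$ is pure, $\mathbf a\mapsto F(\mathbf a)$ is a bijection from $\mathcal S_{k,q}$ onto the set of facets of $T_{k,q}$, and $<$ is a shelling order for $T_{k,q}$. (2) For every $\mathbf a\in\mathcal S_{k,q}$, the restriction of $F(\mathbf a)$ in this shelling order is $\mathcal R(F(\mathbf a))=\{\mathbf v_a^{(k+1-i)}: 1\le i\le k-1,\ a_{i-1}<a_i\}$. (3) For every $0\le i\le k$, $$h_i(T_{k,q})=\Big|\big\{(0,a_1,\dots,a_{k-1})\in\{0\}\times\mathcal S_{k,q}:\ |\{j\in\{1,\dots,k-1\}: a_{j-1}<a_j\}|=i\big\}\Big|.$$ -/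

import Mathlib

namespace Edgewise

/-! ### Simplicial complexes: facets, `h`-vector, shellings

Mathlib's `PreAbstractSimplicialComplex` lists the nonempty faces; the empty face is
accounted for separately (it is `f_{-1} = 1`). -/

section Complexes

variable {V : Type*}

/-- A facet is an inclusion-maximal face. -/
def IsFacet (K : PreAbstractSimplicialComplex V) (s : Finset V) : Prop :=
  Maximal (fun t => t ∈ K.faces) s

/-- All facets have the same number of vertices. -/
def IsPure (K : PreAbstractSimplicialComplex V) : Prop :=
  ∀ s t, IsFacet K s → IsFacet K t → s.card = t.card

/-- `dim K + 1`: the largest number of vertices of a face (for a finite complex). -/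
noncomputable def dimSucc (K : PreAbstractSimplicialComplex V) : ℕ :=
  sSup {n | ∃ s ∈ K.faces, s.card = n}

/-- `f_{i-1}(K)`: the number of faces with exactly `i` vertices; `f_{-1} = 1` counts the
empty face. -/
noncomputable def faceCount (K : PreAbstractSimplicialComplex V) (i : ℕ) : ℕ :=
  if i = 0 then 1 else {s | s ∈ K.faces ∧ s.card = i}.ncard

/-- With `d = dim K` and `0 ≤ s ≤ d + 1`,
`h_s(K) = ∑_{i=0}^{s} (-1)^{s-i} * C(d+1-i, d+1-s) * f_{i-1}(K)`. -/
noncomputable def hVector (K : PreAbstractSimplicialComplex V) (s : ℕ) : ℤ :=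
  ∑ i ∈ Finset.range (s + 1),
    (-1) ^ (s - i) * ((dimSucc K - i).choose (dimSucc K - s) : ℤ) * (faceCount K i : ℤ)

variable [DecidableEq V] {ι : Type*}

/-- The family `F : ι → Finset V`, listed according to the relation `r` on the finite index
set `ι`, is a shelling order of `K`: `K` is pure, `F` enumerates each facet of `K` exactly
once, `r` is a strict linear order, and whenever `F i` comes before `F j` there are `F l`
before `F j` and a vertex `v` of `F j` with `F i ∩ F j ⊆ F l ∩ F j = F j \ {v}`. -/
structure IsShellingOrder (K : PreAbstractSimplicialComplex V) (F : ι → Finset V)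
    (r : ι → ι → Prop) : Prop where
  pure : IsPure K
  finite : Finite ι
  bijOn : Set.BijOn F Set.univ {s | IsFacet K s}
  irrefl : ∀ i, ¬ r i i
  trans : ∀ i j l, r i j → r j l → r i l
  total : ∀ i j, r i j ∨ i = j ∨ r j i
  shell : ∀ i j, r i j → ∃ l, r l j ∧ ∃ v ∈ F j,
    F i ∩ F j ⊆ F l ∩ F j ∧ F l ∩ F j = F j \ {v}

/-- The restriction of the facet `F j` with respect to the order `r`: the vertices `v` of
`F j` such that `F j \ {v}` is contained in an earlier facet. -/
def restriction (F : ι → Finset V) (r : ι → ι → Prop) (j : ι) : Set V :=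
  {v | v ∈ F j ∧ ∃ i, r i j ∧ F j \ {v} ⊆ F i}

end Complexes

/-! ### The edgewise subdivision `T_{k,q}`

Coordinates are indexed by `Fin (k - 1)`: the coordinate `x_i` is `x ⟨i - 1, _⟩`, and the
entry `π_i` of a permutation is `π ⟨i - 1, _⟩`, counted from zero. -/

/-- The lattice points `0 ≤ v_1 ≤ ⋯ ≤ v_{k-1} ≤ q`. -/
def W (k q : ℕ) : Set (Fin (k - 1) → ℤ) :=
  {v | Monotone v ∧ ∀ i, 0 ≤ v i ∧ v i ≤ q}

/-- `π` is consistent with `v`: `i` is before `i + 1` in the word `π` whenever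
`v_i = v_{i+1}`. -/
def Consistent {k : ℕ} (v : Fin (k - 1) → ℤ) (π : Equiv.Perm (Fin (k - 1))) : Prop :=
  ∀ i j : Fin (k - 1), (i : ℕ) + 1 = j → v i = v j → π.symm i < π.symm j

/-- `v^{(i)} = v + e_{π_{k-1}} + e_{π_{k-2}} + ⋯ + e_{π_{k+1-i}}`, for `1 ≤ i ≤ k`. The summand
`e_{π_m}` occurs if and only if `k + 1 - i ≤ m`, and `m = j + 1` for the index `j` below. -/
def vert {k : ℕ} (v : Fin (k - 1) → ℤ) (π : Equiv.Perm (Fin (k - 1))) (i : ℕ) :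
    Fin (k - 1) → ℤ :=
  v + ∑ j ∈ Finset.univ.filter (fun j : Fin (k - 1) => k ≤ (j : ℕ) + i), Pi.single (π j) 1

/-- The vertex set `{v^{(1)}, …, v^{(k)}}` of `F(v, π)`. -/
def cell {k : ℕ} (v : Fin (k - 1) → ℤ) (π : Equiv.Perm (Fin (k - 1))) :
    Finset (Fin (k - 1) → ℤ) :=
  (Finset.Icc 1 k).image (vert v π)

/-- The edgewise subdivision `T_{k,q}`: its faces are the nonempty subsets of the cells
`F(v, π)`, where `v` and `v + (1, …, 1)` are in `W_{k,q}` and `π` is consistent with `v`. -/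
def T (k q : ℕ) : PreAbstractSimplicialComplex (Fin (k - 1) → ℤ) where
  faces := {s | s.Nonempty ∧ ∃ v π, v ∈ W k q ∧ v + 1 ∈ W k q ∧ Consistent v π ∧ s ⊆ cell v π}
  isRelLowerSet_faces := by
    rintro s ⟨hs, v, π, h₁, h₂, h₃, h₄⟩
    exact ⟨hs, fun t hts ht => ⟨ht, v, π, h₁, h₂, h₃, hts.trans h₄⟩⟩

/-! ### Facets as sequences `a ∈ {0, …, q-1}^{k-1}` -/

/-- The sequences `(a_1, …, a_{k-1})` with entries in `{0, …, q-1}`. -/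
abbrev Seq (k q : ℕ) : Type := Fin (k - 1) → Fin q

/-- The permutation `α` with `a_{α_1} ≤ ⋯ ≤ a_{α_{k-1}}`, ties being ordered by increasing
index (`Tuple.sort` is the stable sort). -/
def sortPerm {k q : ℕ} (a : Seq k q) : Equiv.Perm (Fin (k - 1)) := Tuple.sort a

/-- `v_a^{(i)}`, the `i`-th vertex (`1 ≤ i ≤ k`) of `F(a) = F(v_a, α⁻¹)`, where
`v_a = (a_{α_1}, …, a_{α_{k-1}})`. -/
def seqVert {k q : ℕ} (a : Seq k q) (i : ℕ) : Fin (k - 1) → ℤ :=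
  vert (fun j => ((a (sortPerm a j) : ℕ) : ℤ)) (sortPerm a)⁻¹ i

/-- The vertex set `{v_a^{(1)}, …, v_a^{(k)}}` of `F(a)`. -/
def seqFacet {k q : ℕ} (a : Seq k q) : Finset (Fin (k - 1) → ℤ) :=
  (Finset.Icc 1 k).image (seqVert a)

/-- The maximal entry `m(a)` (zero for the empty sequence). -/
def maxEntry {k q : ℕ} (a : Seq k q) : ℕ := Finset.univ.sup fun j => (a j : ℕ)

/-- The sum `S(a)` of the entries. -/
def sumEntries {k q : ℕ} (a : Seq k q) : ℕ := ∑ j, (a j : ℕ)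

/-- `F(a)` comes before `F(b)`: compare `m`, then `S`, then the entries in reversed
lexicographic order (the larger entry at the first difference comes first). -/
def Precedes {k q : ℕ} (a b : Seq k q) : Prop :=
  maxEntry a < maxEntry b ∨
  (maxEntry a = maxEntry b ∧ sumEntries a < sumEntries b) ∨
  (maxEntry a = maxEntry b ∧ sumEntries a = sumEntries b ∧
    ∃ i, b i < a i ∧ ∀ j, j < i → a j = b j)

/-- The sequence `(a_0, a_1, …, a_{k-1})` with `a_0 = 0`. -/
def zeroCons {k q : ℕ} (a : Seq k q) : Fin (k - 1 + 1) → ℕ :=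
  Fin.cons 0 fun j => (a j : ℕ)

/-- The ascents `{i ∈ [k-1] : a_{i-1} < a_i}` of `(0, a_1, …, a_{k-1})`; the ascent `i` is
represented by `j = i - 1` in `Fin (k - 1)`. -/
def ascents {k q : ℕ} (a : Seq k q) : Finset (Fin (k - 1)) :=
  Finset.univ.filter fun j => zeroCons a j.castSucc < zeroCons a j.succ

end Edgewise

/-! Stable sorting of `a` also sorts every word `incr a t`, so the vertices of F(a) are the
multisets of entries of `incr a t`, 0 ≤ t < k (`seqVert_eq_sort`). A shared vertex is an equality of
multisets, and its coordinate sum relates the two indices t.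

Two facts about ascents give everything. For an ascent j of b, some earlier facet contains all
vertices of F(b) except the one with t = j: lower a positive first entry and move it to the end, or
swap the entries at the ascent (`exists_precedes_of_mem_ascents`). Conversely, an earlier facet
misses some ascent vertex of F(b) (`exists_ascent_notMem`); this is shown by counting zeros, large
entries, or entries above a threshold between ascents. Together they yield the shelling condition
and the restrictions. The intervals [R(F), F] then partition the faces, and binomial inversion gives
the h-vector. -/

namespace Edgewise

/-! ### Shellings, interval partitions and the h-vector -/

section Shelling

variable {V ι : Type*} [DecidableEq V] {K : PreAbstractSimplicialComplex V}
  {F : ι → Finset V} {r : ι → ι → Prop}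

/-- In a shelling order, every set contained in some facet lies in exactly one of the intervals
`[R(F i), F i]`. -/
theorem IsShellingOrder.existsUnique_interval (h : IsShellingOrder K F r) (s : Finset V)
    (hs : ∃ i, s ⊆ F i) : ∃! i, restriction F r i ⊆ s ∧ s ⊆ F i := by
  have hfin := h.finite
  have hir : Std.Irrefl r := ⟨h.irrefl⟩
  have htr : IsTrans ι r := ⟨h.trans⟩
  -- No earlier facet contains such an s: the exchange vertex v lies in R(F j) ⊆ s, yet F i ∩ F j
  -- omits v.
  have key : ∀ i j, restriction F r j ⊆ s → s ⊆ F j → s ⊆ F i → ¬ r i j := by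
    intro i j hR hj hi hij
    obtain ⟨l, hl, v, hv, hsub, heq⟩ := h.shell i j hij
    have hvs : v ∈ s := by
      apply hR
      exact ⟨hv, l, hl, by rw [← heq]; exact Finset.inter_subset_left⟩
    have : v ∈ F j \ {v} := by
      rw [← heq]; exact hsub (Finset.mem_inter.2 ⟨hi hvs, hj hvs⟩)
    simp at this
  have wf : WellFounded r := Finite.wellFounded_of_trans_of_irrefl r
  -- In the earliest facet containing s, a restriction vertex outside s would put s into a still
  -- earlier facet.
  obtain ⟨i, hi, hmin⟩ := wf.has_min {i | s ⊆ F i} hs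
  refine ⟨i, ⟨?_, hi⟩, ?_⟩
  · rintro v ⟨hv, l, hl, hsub⟩
    by_contra hvs
    refine hmin l ?_ hl
    intro x hx
    refine hsub (Finset.mem_sdiff.2 ⟨hi hx, ?_⟩)
    rw [Finset.mem_singleton]
    rintro rfl
    exact hvs hx
  · rintro j ⟨hR, hj⟩
    rcases h.total i j with hij | rfl | hij
    · exact absurd hij (key i j hR hj hi)
    · rfl
    · exact absurd hij (hmin j hj)

/-- The number of sets of size `c` in an interval of finite sets. -/
theorem card_Icc_filter_card {A B : Finset V} (hAB : A ⊆ B) (c : ℕ) :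
    ((Finset.Icc A B).filter fun s => s.card = c).card =
      if A.card ≤ c then (B.card - A.card).choose (c - A.card) else 0 := by
  split_ifs with hc
  · rw [← Finset.card_sdiff_of_subset hAB, ← Finset.card_powersetCard]
    symm
    refine Finset.card_bij (fun s _ => A ∪ s) ?_ ?_ ?_
    · intro s hs
      rw [Finset.mem_powersetCard] at hs
      have hd : Disjoint A s := Finset.disjoint_of_subset_right hs.1 Finset.disjoint_sdiff
      rw [Finset.mem_filter, Finset.mem_Icc, Finset.card_union_of_disjoint hd, hs.2]
      refine ⟨⟨Finset.subset_union_left, ?_⟩, by omega⟩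
      exact Finset.union_subset hAB (hs.1.trans Finset.sdiff_subset)
    · intro s hs t ht hst
      rw [Finset.mem_powersetCard] at hs ht
      have h1 : Disjoint A s := Finset.disjoint_of_subset_right hs.1 Finset.disjoint_sdiff
      have h2 : Disjoint A t := Finset.disjoint_of_subset_right ht.1 Finset.disjoint_sdiff
      rw [← Finset.union_sdiff_cancel_left h1, ← Finset.union_sdiff_cancel_left h2, hst]
    · intro s hs
      rw [Finset.mem_filter, Finset.mem_Icc] at hs
      refine ⟨s \ A, ?_, Finset.union_sdiff_of_subset hs.1.1⟩
      rw [Finset.mem_powersetCard, Finset.card_sdiff_of_subset hs.1.1, hs.2]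
      exact ⟨Finset.sdiff_subset_sdiff hs.1.2 le_rfl, rfl⟩
  · rw [Finset.card_eq_zero, Finset.filter_eq_empty_iff]
    intro s hs h
    rw [Finset.mem_Icc] at hs
    exact hc (h ▸ Finset.card_le_card hs.1)

/-- Inversion of the binomial transform for a single interval. -/
theorem alternating_sum_choose_mul_choose {d r s : ℕ} (hs : s ≤ d) :
    ∑ i ∈ Finset.range (s + 1), (-1 : ℤ) ^ (s - i) * ((d - i).choose (d - s) : ℤ) *
      ((if r ≤ i then (d - r).choose (i - r) else 0 : ℕ) : ℤ) = if r = s then 1 else 0 := by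
  rcases lt_or_ge s r with h | h
  · rw [if_neg (by omega)]
    refine Finset.sum_eq_zero fun i hi => ?_
    rw [Finset.mem_range] at hi
    rw [if_neg (by omega)]
    simp
  obtain ⟨m, rfl⟩ := Nat.exists_eq_add_of_le h
  have h1 : r + m + 1 = r + (m + 1) := by ring
  rw [h1, Finset.sum_range_add]
  have h2 : ∑ i ∈ Finset.range r, (-1 : ℤ) ^ (r + m - i) * ((d - i).choose (d - (r + m)) : ℤ) *
      ((if r ≤ i then (d - r).choose (i - r) else 0 : ℕ) : ℤ) = 0 := by
    refine Finset.sum_eq_zero fun i hi => ?_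
    rw [Finset.mem_range] at hi
    rw [if_neg (by omega)]
    simp
  rw [h2, zero_add]
  -- Trinomial revision isolates an alternating row sum of Pascal's triangle, zero unless m = 0.
  have h3 : ∀ i ∈ Finset.range (m + 1), (-1 : ℤ) ^ (r + m - (r + i)) *
      ((d - (r + i)).choose (d - (r + m)) : ℤ) *
      ((if r ≤ r + i then (d - r).choose (r + i - r) else 0 : ℕ) : ℤ) =
      (-1) ^ m * ((d - r).choose m : ℤ) * ((-1) ^ i * (m.choose i : ℤ)) := by
    intro i hi
    have him : i ≤ m := by rw [Finset.mem_range] at hi; omega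
    rw [if_pos (by omega), Nat.add_sub_cancel_left, Nat.add_sub_add_left]
    have e1 : (d - (r + i)).choose (d - (r + m)) = (d - r - i).choose (m - i) := by
      rw [← Nat.choose_symm_of_eq_add (n := d - r - i) (a := d - (r + m)) (b := m - i) (by omega)]
      congr 1; omega
    have e2 := Nat.choose_mul (n := d - r) (k := m) (s := i) him
    have e3 : (-1 : ℤ) ^ m * (-1) ^ i = (-1) ^ (m - i) := by
      obtain ⟨j, rfl⟩ := Nat.exists_eq_add_of_le him
      rw [Nat.add_sub_cancel_left, pow_add]
      have e4 : ((-1 : ℤ) ^ i) * (-1) ^ i = 1 := by rw [← mul_pow]; simp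
      linear_combination (-1) ^ j * e4
    rw [e1, ← e3]
    have e2' : ((d - r).choose m : ℤ) * (m.choose i : ℤ) =
      ((d - r).choose i : ℤ) * ((d - r - i).choose (m - i) : ℤ) := by exact_mod_cast e2
    linear_combination (-((-1) ^ m * (-1) ^ i)) * e2'
  rw [Finset.sum_congr rfl h3, ← Finset.mul_sum, Int.alternating_sum_range_choose]
  by_cases hm : m = 0
  · subst hm; simp
  · rw [if_neg hm, if_neg (by omega), mul_zero]

/-- The `h`-vector of a shellable complex counts the facets by the size of their restriction. -/
theorem IsShellingOrder.hVector_eq [Fintype ι] [Nonempty ι] (h : IsShellingOrder K F r)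
    (hK : ∀ s, s ∈ K.faces ↔ s.Nonempty ∧ ∃ i, s ⊆ F i) {d : ℕ} (hd : 1 ≤ d)
    (hF : ∀ i, (F i).card = d) (R : ι → Finset V) (hR : ∀ i, (R i : Set V) = restriction F r i)
    {s : ℕ} (hs : s ≤ d) :
    hVector K s = ((Finset.univ.filter fun i => (R i).card = s).card : ℤ) := by
  have hRF : ∀ i, R i ⊆ F i := by
    intro i x hx
    have : x ∈ restriction F r i := by rw [← hR]; exact hx
    exact this.1
  have hdim : dimSucc K = d := by
    obtain ⟨i⟩ := ‹Nonempty ι›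
    refine IsGreatest.csSup_eq ⟨⟨F i, (hK _).2 ⟨?_, i, le_rfl⟩, hF i⟩, ?_⟩
    · rw [← Finset.card_pos, hF]; omega
    · rintro _ ⟨s, hs, rfl⟩
      obtain ⟨-, j, hj⟩ := (hK _).1 hs
      exact hF j ▸ Finset.card_le_card hj
  have hcount : ∀ c, faceCount K c =
      ∑ i, if (R i).card ≤ c then (d - (R i).card).choose (c - (R i).card) else 0 := by
    intro c
    have e1 : faceCount K c =
        ((Finset.univ.biUnion fun i => (F i).powerset).filter fun s => s.card = c).card := by
      unfold faceCount
      split_ifs with hc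
      · subst hc
        symm
        rw [Finset.card_eq_one]
        refine ⟨∅, ?_⟩
        ext s
        simp only [Finset.mem_filter, Finset.mem_biUnion, Finset.mem_univ, true_and,
          Finset.mem_powerset, Finset.card_eq_zero, Finset.mem_singleton]
        constructor
        · exact fun hs => hs.2
        · rintro rfl
          exact ⟨⟨Classical.arbitrary ι, Finset.empty_subset _⟩, rfl⟩
      · rw [← Set.ncard_coe_finset]
        congr 1
        ext s
        simp only [Set.mem_ofPred_eq, hK, Finset.coe_filter, Finset.mem_biUnion, Finset.mem_univ,
          true_and, Finset.mem_powerset]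
        constructor
        · exact fun hs => ⟨hs.1.2, hs.2⟩
        · refine fun hs => ⟨⟨?_, hs.1⟩, hs.2⟩
          rw [← Finset.card_pos]; omega
    have e2 : ((Finset.univ.biUnion fun i => (F i).powerset).filter fun s => s.card = c) =
        Finset.univ.biUnion fun i => (Finset.Icc (R i) (F i)).filter fun s => s.card = c := by
      ext s
      simp only [Finset.mem_filter, Finset.mem_biUnion, Finset.mem_univ, true_and,
        Finset.mem_powerset, Finset.mem_Icc]
      constructor
      · rintro ⟨hs, hc⟩
        obtain ⟨i, ⟨h1, h2⟩, -⟩ := h.existsUnique_interval s hs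
        rw [← hR] at h1
        exact ⟨i, ⟨by exact_mod_cast h1, h2⟩, hc⟩
      · rintro ⟨i, ⟨-, h2⟩, hc⟩
        exact ⟨⟨i, h2⟩, hc⟩
    rw [e1, e2, Finset.card_biUnion]
    · refine Finset.sum_congr rfl fun i _ => ?_
      rw [card_Icc_filter_card (hRF i), hF]
    · intro i _ j _ hij
      refine Finset.disjoint_left.2 ?_
      intro s hsi hsj
      rw [Finset.mem_filter, Finset.mem_Icc] at hsi hsj
      refine hij ((h.existsUnique_interval s ⟨i, hsi.1.2⟩).unique ⟨?_, hsi.1.2⟩ ⟨?_, hsj.1.2⟩)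
      · rw [← hR]; exact_mod_cast hsi.1.1
      · rw [← hR]; exact_mod_cast hsj.1.1
  unfold hVector
  simp only [hdim, hcount, Nat.cast_sum, Finset.mul_sum]
  rw [Finset.sum_comm, Finset.card_filter, Nat.cast_sum]
  refine Finset.sum_congr rfl fun i _ => ?_
  rw [alternating_sum_choose_mul_choose hs]
  simp

end Shelling

/-! ### Vertices as sorted words, facets as sequences -/

section Cells

variable {k q : ℕ}

/-- The sequence `a` with the entries of index at least `t` (counted from zero) increased
by one. -/
def incr (a : Seq k q) (t : ℕ) : Fin (k - 1) → ℕ :=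
  fun j => (a j : ℕ) + if t ≤ (j : ℕ) then 1 else 0

theorem incr_of_le (a : Seq k q) {t j : Fin (k - 1)} (h : t ≤ j) :
    incr a t j = (a j : ℕ) + 1 := by
  rw [incr, if_pos (Fin.le_def.1 h)]

theorem incr_of_lt (a : Seq k q) {t j : Fin (k - 1)} (h : j < t) : incr a t j = (a j : ℕ) := by
  rw [incr, if_neg (not_le.2 (Fin.lt_def.1 h)), add_zero]

theorem incr_congr {a b : Seq k q} (t : ℕ) {j : Fin (k - 1)} (h : a j = b j) :
    incr a t j = incr b t j := by
  rw [incr, incr, h]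

theorem vert_apply (v : Fin (k - 1) → ℤ) (π : Equiv.Perm (Fin (k - 1))) (i : ℕ)
    (p : Fin (k - 1)) :
    vert v π i p = v p + if k ≤ (π.symm p : ℕ) + i then 1 else 0 := by
  have h : ∀ j : Fin (k - 1), (Pi.single (π j) (1 : ℤ) : Fin (k - 1) → ℤ) p =
      if j = π.symm p then 1 else 0 := by
    intro j
    rw [Pi.single_apply]
    congr 1
    rw [Equiv.eq_symm_apply, eq_comm (a := p)]
  simp only [vert, Pi.add_apply, Finset.sum_apply, h, Finset.sum_ite_eq', Finset.mem_filter,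
    Finset.mem_univ, true_and]

theorem seqVert_apply (a : Seq k q) {t : ℕ} (ht : t < k) (p : Fin (k - 1)) :
    seqVert a (k - t) p = (incr a t (sortPerm a p) : ℤ) := by
  have h : ((sortPerm a)⁻¹).symm p = sortPerm a p := rfl
  rw [seqVert, vert_apply, h, incr]
  push_cast
  congr 1
  refine if_congr ?_ rfl rfl
  omega

/-- Ties are sorted by index, so raising a final segment respects them; a strict inequality of
integers stays weak when its smaller side grows by one. -/
theorem monotone_incr_sortPerm (a : Seq k q) (t : ℕ) : Monotone (incr a t ∘ sortPerm a) := by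
  obtain ⟨h1, h2⟩ := Tuple.eq_sort_iff.1 (rfl : sortPerm a = Tuple.sort a)
  intro i j hij
  rcases hij.eq_or_lt with rfl | hij
  · exact le_rfl
  have h3 : a (sortPerm a i) ≤ a (sortPerm a j) := h1 hij.le
  have h4 := h2 i j hij
  simp only [Function.comp, incr]
  rcases h3.eq_or_lt with h | h
  · have h5 : sortPerm a i < sortPerm a j := h4 h
    rw [h]
    split_ifs <;> omega
  · split_ifs <;> omega

/-- The vertices of `F(a)` are the sorted sequences obtained by increasing a final segment
of `a`. -/
theorem seqVert_eq_sort (a : Seq k q) {t : ℕ} (ht : t < k) :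
    seqVert a (k - t) = fun p => (((incr a t ∘ Tuple.sort (incr a t)) p : ℕ) : ℤ) := by
  rw [← Tuple.comp_sort_eq_comp_iff_monotone.2 (monotone_incr_sortPerm a t)]
  funext p
  exact seqVert_apply a ht p

theorem seqVert_congr {a b : Seq k q} {s t : ℕ} (hs : s < k) (ht : t < k)
    (σ : Equiv.Perm (Fin (k - 1))) (h : ∀ j, incr b s (σ j) = incr a t j) :
    seqVert a (k - t) = seqVert b (k - s) := by
  have : incr a t = incr b s ∘ σ := funext fun j => (h j).symm
  rw [seqVert_eq_sort a ht, seqVert_eq_sort b hs, this, Tuple.comp_perm_comp_sort_eq_comp_sort]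

/-- Equal vertices are equal multisets; a suitable `f` counts zeros or large entries on both sides.
-/
theorem sum_incr_eq_of_seqVert_eq {a b : Seq k q} {s t : ℕ} (hs : s < k) (ht : t < k)
    (h : seqVert a (k - t) = seqVert b (k - s)) (f : ℕ → ℕ) :
    ∑ j, f (incr a t j) = ∑ j, f (incr b s j) := by
  rw [← Equiv.sum_comp (sortPerm a) fun j => f (incr a t j),
    ← Equiv.sum_comp (sortPerm b) fun j => f (incr b s j)]
  refine Finset.sum_congr rfl fun p _ => ?_
  have := congrFun h p
  rw [seqVert_apply a ht, seqVert_apply b hs] at this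
  rw [Nat.cast_injective this]

theorem sum_incr (a : Seq k q) {t : ℕ} (ht : t < k) :
    ∑ j, incr a t j + t = sumEntries a + (k - 1) := by
  have h : (Finset.univ.filter fun j : Fin (k - 1) => (j : ℕ) < t).card = t := by
    rw [Fin.card_filter_val_lt]; omega
  have h2 := Finset.card_filter_add_card_filter_not (s := (Finset.univ : Finset (Fin (k - 1))))
    fun j => t ≤ (j : ℕ)
  simp only [not_le, h, Finset.card_univ, Fintype.card_fin] at h2
  simp only [incr, Finset.sum_add_distrib, sumEntries, ← Finset.card_filter]
  omega

theorem add_sumEntries_eq {a b : Seq k q} {s t : ℕ} (hs : s < k) (ht : t < k)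
    (h : seqVert a (k - t) = seqVert b (k - s)) : sumEntries a + s = sumEntries b + t := by
  have h1 := sum_incr_eq_of_seqVert_eq hs ht h id
  have h2 := sum_incr a ht
  have h3 := sum_incr b hs
  simp only [id] at h1
  omega

theorem seqVert_injOn (a : Seq k q) {s t : ℕ} (hs : s < k) (ht : t < k)
    (h : seqVert a (k - t) = seqVert a (k - s)) : s = t := by
  have := add_sumEntries_eq hs ht h
  omega

theorem mem_seqFacet {a : Seq k q} {x : Fin (k - 1) → ℤ} :
    x ∈ seqFacet a ↔ ∃ t < k, x = seqVert a (k - t) := by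
  simp only [seqFacet, Finset.mem_image, Finset.mem_Icc]
  constructor
  · rintro ⟨i, hi, rfl⟩
    exact ⟨k - i, by omega, by congr 1; omega⟩
  · rintro ⟨t, ht, rfl⟩
    exact ⟨k - t, by omega, rfl⟩

theorem card_seqFacet (a : Seq k q) : (seqFacet a).card = k := by
  rw [seqFacet, Finset.card_image_of_injOn, Nat.card_Icc, Nat.add_sub_cancel]
  intro i hi j hj h
  simp only [Finset.coe_Icc, Set.mem_Icc] at hi hj
  have h1 : i = k - (k - i) := by omega
  have h2 : j = k - (k - j) := by omega
  have h' : seqVert a i = seqVert a j := h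
  rw [h1, h2] at h'
  have := seqVert_injOn a (by omega) (by omega) h'
  omega

/-- The least coordinate sum recovers S(a), and sums then match vertices of equal t. The vertex t =
k - 1 raises nothing and shows the sorted values; the others show for which t each sorted position
is raised, hence the sorting permutation. -/
theorem seqFacet_injective (hk : 1 ≤ k) :
    Function.Injective (seqFacet : Seq k q → Finset (Fin (k - 1) → ℤ)) := by
  intro a b hab
  have hS : ∀ a b : Seq k q, seqFacet a = seqFacet b → sumEntries b ≤ sumEntries a := by
    intro a b hab
    have : seqVert a (k - (k - 1)) ∈ seqFacet b := by
      rw [← hab, mem_seqFacet]; exact ⟨k - 1, by omega, rfl⟩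
    obtain ⟨s, hs, h⟩ := mem_seqFacet.1 this
    have := add_sumEntries_eq hs (by omega) h
    omega
  have hSab : sumEntries a = sumEntries b := le_antisymm (hS b a hab.symm) (hS a b hab)
  have hv : ∀ t < k, seqVert a (k - t) = seqVert b (k - t) := by
    intro t ht
    have : seqVert a (k - t) ∈ seqFacet b := by
      rw [← hab, mem_seqFacet]; exact ⟨t, ht, rfl⟩
    obtain ⟨s, hs, h⟩ := mem_seqFacet.1 this
    have := add_sumEntries_eq hs ht h
    rw [h]; congr 2; omega
  have hv' : ∀ t < k, ∀ p, incr a t (sortPerm a p) = incr b t (sortPerm b p) := by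
    intro t ht p
    have := congrFun (hv t ht) p
    rw [seqVert_apply a ht, seqVert_apply b ht] at this
    exact_mod_cast this
  have hval : ∀ p, (a (sortPerm a p) : ℕ) = b (sortPerm b p) := by
    intro p
    have := hv' (k - 1) (by omega) p
    simp only [incr] at this
    rwa [if_neg (by omega), if_neg (by omega)] at this
  have hperm : sortPerm a = sortPerm b := by
    ext p
    have h1 := hv' (sortPerm a p) (by omega) p
    have h2 := hv' (sortPerm b p) (by omega) p
    have h3 := hval p
    simp only [incr] at h1 h2
    split_ifs at h1 h2 <;> omega
  funext j
  have := hval ((sortPerm a).symm j)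
  rw [← hperm, Equiv.apply_symm_apply] at this
  exact Fin.ext this

theorem seqFacet_eq_cell (a : Seq k q) :
    seqFacet a = cell (fun j => ((a (sortPerm a j) : ℕ) : ℤ)) (sortPerm a)⁻¹ := rfl

/-- Monotonicity makes `v` constant between equal entries, so the condition on neighbours chains. -/
theorem Consistent.lt_of_lt {v : Fin (k - 1) → ℤ} {π : Equiv.Perm (Fin (k - 1))}
    (h : Consistent v π) (hv : Monotone v) {i j : Fin (k - 1)} (hij : i < j) (he : v i = v j) :
    π.symm i < π.symm j := by
  obtain ⟨m, hm⟩ := Nat.exists_eq_add_of_lt (Fin.lt_def.1 hij)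
  induction m generalizing j with
  | zero => exact h i j (by omega) he
  | succ m ih =>
    have hlt : (i : ℕ) + m + 1 < k - 1 := by omega
    let l : Fin (k - 1) := ⟨i + m + 1, hlt⟩
    have hil : i < l := by rw [Fin.lt_def]; simp only [l]; omega
    have hlj : l < j := by rw [Fin.lt_def]; simp only [l]; omega
    have h1 := hv hil.le
    have h2 := hv hlj.le
    exact (ih hil (by omega) (by simp only [l])).trans
      (h l j (by simp only [l]; omega) (by omega))

/-- The cells `F(v, π)` of the edgewise subdivision are the sets `F(a)`. -/
theorem exists_cell_iff {s : Finset (Fin (k - 1) → ℤ)} :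
    (∃ v π, v ∈ W k q ∧ v + 1 ∈ W k q ∧ Consistent v π ∧ s ⊆ cell v π) ↔
      ∃ a : Seq k q, s ⊆ seqFacet a := by
  constructor
  · rintro ⟨v, π, ⟨hv, hv0⟩, ⟨-, hv1⟩, hc, hs⟩
    have hlt : ∀ j, (v j).toNat < q := by
      intro j
      have h0 := (hv0 j).1
      have h1 := (hv1 j).2
      simp only [Pi.add_apply, Pi.one_apply] at h1
      omega
    -- Entry j is the coordinate of `v` that π_j raises; consistency makes π⁻¹ its stable sort.
    let a : Seq k q := fun j => ⟨(v (π j)).toNat, hlt _⟩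
    have hsort : π.symm = sortPerm a := by
      refine Tuple.eq_sort_iff.2 ⟨?_, ?_⟩
      · intro i j hij
        have := hv hij
        simp only [Function.comp, a, Fin.mk_le_mk, Equiv.apply_symm_apply]
        omega
      · intro i j hij he
        simp only [a, Fin.mk.injEq, Equiv.apply_symm_apply] at he
        refine hc.lt_of_lt hv hij ?_
        have h0 := (hv0 i).1
        have h1 := (hv0 j).1
        omega
    refine ⟨a, ?_⟩
    rw [seqFacet_eq_cell, ← hsort]
    have hva : (fun j => ((a (π.symm j) : ℕ) : ℤ)) = v := by
      funext j
      simp only [a, Equiv.apply_symm_apply]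
      exact Int.toNat_of_nonneg (hv0 j).1
    rw [hva]
    exact hs
  · rintro ⟨a, hs⟩
    obtain ⟨h1, h2⟩ := Tuple.eq_sort_iff.1 (rfl : sortPerm a = Tuple.sort a)
    have hmono : Monotone fun j => ((a (sortPerm a j) : ℕ) : ℤ) := by
      intro i j hij
      have : a (sortPerm a i) ≤ a (sortPerm a j) := h1 hij
      exact Int.ofNat_le.2 this
    refine ⟨_, (sortPerm a)⁻¹, ⟨hmono, ?_⟩, ⟨?_, ?_⟩, ?_, by rwa [seqFacet_eq_cell] at hs⟩
    · intro i
      have := (a (sortPerm a i)).isLt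
      omega
    · exact hmono.add_const 1
    · intro i
      have := (a (sortPerm a i)).isLt
      simp only [Pi.add_apply, Pi.one_apply]
      omega
    · intro i j hij he
      refine h2 i j (Fin.lt_def.2 (by omega)) (Fin.ext ?_)
      exact Int.ofNat_inj.1 he

theorem mem_faces_T {s : Finset (Fin (k - 1) → ℤ)} :
    s ∈ (T k q).faces ↔ s.Nonempty ∧ ∃ a : Seq k q, s ⊆ seqFacet a :=
  and_congr_right fun _ => exists_cell_iff

theorem isFacet_T_iff (hk : 1 ≤ k) {s : Finset (Fin (k - 1) → ℤ)} :
    IsFacet (T k q) s ↔ ∃ a : Seq k q, s = seqFacet a := by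
  have hface : ∀ a : Seq k q, seqFacet a ∈ (T k q).faces := fun a =>
    mem_faces_T.2 ⟨by rw [← Finset.card_pos, card_seqFacet]; omega, a, le_rfl⟩
  constructor
  · rintro ⟨hs, hmax⟩
    obtain ⟨-, a, ha⟩ := mem_faces_T.1 hs
    exact ⟨a, le_antisymm ha (hmax (hface a) ha)⟩
  · rintro ⟨a, rfl⟩
    refine ⟨hface a, fun t ht hat => ?_⟩
    obtain ⟨-, b, hb⟩ := mem_faces_T.1 ht
    have := Finset.eq_of_subset_of_card_le (Finset.Subset.trans hat hb)
      (by rw [card_seqFacet, card_seqFacet])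
    rw [this]
    exact hb

theorem isPure_T (hk : 1 ≤ k) : IsPure (T k q) := by
  intro s t hs ht
  obtain ⟨a, rfl⟩ := (isFacet_T_iff hk).1 hs
  obtain ⟨b, rfl⟩ := (isFacet_T_iff hk).1 ht
  rw [card_seqFacet, card_seqFacet]

end Cells

/-! ### The facet order is linear -/

section Order

variable {k q : ℕ}

theorem precedes_iff_toLex {a b : Seq k q} :
    Precedes a b ↔ maxEntry a < maxEntry b ∨
      (maxEntry a = maxEntry b ∧ sumEntries a < sumEntries b) ∨
      (maxEntry a = maxEntry b ∧ sumEntries a = sumEntries b ∧ toLex b < toLex a) := by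
  have h : (∃ i, b i < a i ∧ ∀ j, j < i → a j = b j) ↔ toLex b < toLex a :=
    ⟨fun ⟨i, h1, h2⟩ => ⟨i, fun j hj => (h2 j hj).symm, h1⟩,
      fun ⟨i, h1, h2⟩ => ⟨i, h2, fun j hj => (h1 j hj).symm⟩⟩
  rw [Precedes, h]

theorem precedes_irrefl (a : Seq k q) : ¬ Precedes a a := by
  rw [precedes_iff_toLex]
  rintro (h | ⟨-, h⟩ | ⟨-, -, h⟩)
  · exact lt_irrefl _ h
  · exact lt_irrefl _ h
  · exact lt_irrefl _ h

theorem precedes_trans {a b c : Seq k q} (h1 : Precedes a b) (h2 : Precedes b c) :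
    Precedes a c := by
  rw [precedes_iff_toLex] at *
  rcases h1 with h1 | ⟨h1, h1'⟩ | ⟨h1, h1', h1''⟩ <;>
    rcases h2 with h2 | ⟨h2, h2'⟩ | ⟨h2, h2', h2''⟩
  all_goals first
    | (left; omega)
    | (right; left; omega)
    | (right; right; exact ⟨h1.trans h2, h1'.trans h2', h2''.trans h1''⟩)

theorem precedes_total (a b : Seq k q) : Precedes a b ∨ a = b ∨ Precedes b a := by
  rw [precedes_iff_toLex, precedes_iff_toLex]
  rcases lt_trichotomy (maxEntry a) (maxEntry b) with h | h | h
  · exact Or.inl (Or.inl h)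
  · rcases lt_trichotomy (sumEntries a) (sumEntries b) with h' | h' | h'
    · exact Or.inl (Or.inr (Or.inl ⟨h, h'⟩))
    · rcases lt_trichotomy (toLex a) (toLex b) with h'' | h'' | h''
      · exact Or.inr (Or.inr (Or.inr (Or.inr ⟨h.symm, h'.symm, h''⟩)))
      · exact Or.inr (Or.inl (toLex_inj.1 h''))
      · exact Or.inl (Or.inr (Or.inr ⟨h, h', h''⟩))
    · exact Or.inr (Or.inr (Or.inr (Or.inl ⟨h.symm, h'⟩)))
  · exact Or.inr (Or.inr (Or.inl h))

end Order

/-! ### Ascents of a word -/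

section Ascents

variable {k q : ℕ}

theorem mem_ascents {a : Seq k q} {j : Fin (k - 1)} :
    j ∈ ascents a ↔
      ((j : ℕ) = 0 → 0 < (a j : ℕ)) ∧ ∀ i : Fin (k - 1), (i : ℕ) + 1 = j → a i < a j := by
  simp only [ascents, Finset.mem_filter, Finset.mem_univ, true_and, zeroCons, Fin.cons_succ]
  by_cases h : (j : ℕ) = 0
  · have h0 : j.castSucc = 0 := Fin.ext h
    rw [h0, Fin.cons_zero]
    exact ⟨fun h1 => ⟨fun _ => h1, fun i hi => by omega⟩, fun h1 => h1.1 h⟩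
  · let i : Fin (k - 1) := ⟨j - 1, by omega⟩
    have hi : j.castSucc = i.succ := Fin.ext (by simp [i]; omega)
    rw [hi, Fin.cons_succ]
    constructor
    · refine fun h1 => ⟨fun h2 => absurd h2 h, fun l hl => ?_⟩
      have : l = i := Fin.ext (by simp [i]; omega)
      rw [this]
      exact h1
    · exact fun h1 => h1.2 i (by simp [i]; omega)

theorem pos_of_mem_ascents {a : Seq k q} {j : Fin (k - 1)} (h : j ∈ ascents a) :
    0 < (a j : ℕ) := by
  rw [mem_ascents] at h
  by_cases hj : (j : ℕ) = 0
  · exact h.1 hj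
  · have := h.2 ⟨j - 1, by omega⟩ (by simp only; omega)
    omega

/-- Without ascents in `(i, l]` the entries do not increase from `i` to `l`. -/
theorem le_of_forall_notMem_ascents {a : Seq k q} {i l : Fin (k - 1)} (hil : i ≤ l)
    (h : ∀ p, i < p → p ≤ l → p ∉ ascents a) : a l ≤ a i := by
  obtain ⟨m, hm⟩ := Nat.exists_eq_add_of_le (Fin.le_def.1 hil)
  induction m generalizing l with
  | zero => rw [show l = i from Fin.ext (by omega)]
  | succ m ih =>
    let l' : Fin (k - 1) := ⟨i + m, by omega⟩
    have hl' : (l' : ℕ) = i + m := rfl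
    have h1 := ih (l := l') (Fin.le_def.2 (by omega))
      (fun p hp hpl => h p hp (Fin.le_def.2 (by have := Fin.le_def.1 hpl; omega))) hl'
    refine le_trans ?_ h1
    have h2 := h l (Fin.lt_def.2 (by omega)) le_rfl
    rw [mem_ascents] at h2
    by_contra hlt
    refine h2 ⟨fun h0 => by omega, fun x hx => ?_⟩
    rw [show x = l' from Fin.ext (by omega)]
    exact not_le.1 hlt

/-- Before the first ascent of `(0, a_1, …, a_{k-1})` all entries vanish. -/
theorem eq_zero_of_forall_notMem_ascents {a : Seq k q} {l : Fin (k - 1)}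
    (h : ∀ p, p ≤ l → p ∉ ascents a) : (a l : ℕ) = 0 := by
  let z : Fin (k - 1) := ⟨0, (Nat.zero_le _).trans_lt l.isLt⟩
  have hz : z ≤ l := Fin.le_def.2 (Nat.zero_le _)
  have h1 : a l ≤ a z := le_of_forall_notMem_ascents hz fun p _ hp => h p hp
  have h2 := h z hz
  rw [mem_ascents] at h2
  by_contra hne
  have h3 : (a l : ℕ) ≤ a z := h1
  exact h2 ⟨fun _ => by omega, fun i hi => absurd hi (by simp [z])⟩

theorem exists_first_ascent {a : Seq k q} (h : (ascents a).Nonempty) :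
    ∃ j ∈ ascents a, ∀ l < j, (a l : ℕ) = 0 :=
  ⟨_, Finset.min'_mem _ h, fun _ hl => eq_zero_of_forall_notMem_ascents fun p hpl hp =>
    absurd (Finset.min'_le _ p hp) (not_le.2 (hpl.trans_lt hl))⟩

theorem exists_last_ascent (a : Seq k q) (i : Fin (k - 1)) :
    (∃ p ∈ ascents a, p ≤ i ∧ a i ≤ a p) ∨ ∀ l ≤ i, l ∉ ascents a := by
  by_cases h : ((ascents a).filter (· ≤ i)).Nonempty
  · left
    have hp := Finset.mem_filter.1 (Finset.max'_mem _ h)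
    refine ⟨_, hp.1, hp.2, le_of_forall_notMem_ascents hp.2 fun p hp1 hp2 hp3 => ?_⟩
    exact absurd (Finset.le_max' _ p (Finset.mem_filter.2 ⟨hp3, hp2⟩)) (not_le.2 hp1)
  · right
    intro l hl hla
    exact h ⟨l, Finset.mem_filter.2 ⟨hla, hl⟩⟩

theorem exists_next_ascent (a : Seq k q) (i : Fin (k - 1)) :
    (∃ p ∈ ascents a, i < p ∧ ∀ l, i ≤ l → l < p → a l ≤ a i) ∨ ∀ l, i ≤ l → a l ≤ a i := by
  by_cases h : ((ascents a).filter (i < ·)).Nonempty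
  · left
    have hp := Finset.mem_filter.1 (Finset.min'_mem _ h)
    refine ⟨_, hp.1, hp.2, fun l hil hlp => le_of_forall_notMem_ascents hil fun p hp1 hp2 hp3 => ?_⟩
    exact absurd (Finset.min'_le _ p (Finset.mem_filter.2 ⟨hp3, hp1⟩)) (not_le.2 (hp2.trans_lt hlp))
  · right
    refine fun l hil => le_of_forall_notMem_ascents hil fun p hp1 _ hp3 => ?_
    exact h ⟨p, Finset.mem_filter.2 ⟨hp3, hp1⟩⟩

/-! ### Earlier neighbours opposite ascent vertices -/

theorem exists_rotation (n : ℕ) :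
    ∃ ρ : Equiv.Perm (Fin n), ∀ x, (ρ x : ℕ) = if (x : ℕ) + 1 = n then 0 else (x : ℕ) + 1 := by
  cases n with
  | zero => exact ⟨1, fun x => x.elim0⟩
  | succ n =>
    refine ⟨finRotate (n + 1), fun x => ?_⟩
    rw [coe_finRotate]
    refine if_congr ?_ rfl rfl
    rw [Fin.ext_iff, Fin.val_last]
    omega

/-- If the first entry is positive, the facet obtained by moving it to the end and lowering it by
one comes earlier and contains all vertices of `F(b)` but one. -/
theorem exists_precedes_of_zero (b : Seq k q) (j : Fin (k - 1)) (hj : (j : ℕ) = 0)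
    (hb : 0 < (b j : ℕ)) :
    ∃ c : Seq k q, Precedes c b ∧ ∀ t < k, t ≠ j → seqVert b (k - t) ∈ seqFacet c := by
  obtain ⟨ρ, hρ⟩ := exists_rotation (k - 1)
  let c : Seq k q := fun x =>
    if (x : ℕ) + 1 = k - 1 then ⟨(b (ρ x) : ℕ) - 1, by omega⟩ else b (ρ x)
  have hc : ∀ x, (c x : ℕ) = if (x : ℕ) + 1 = k - 1 then (b (ρ x) : ℕ) - 1 else b (ρ x) := by
    intro x
    simp only [c]
    split_ifs <;> rfl
  have hle : ∀ x, (c x : ℕ) ≤ b (ρ x) := by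
    intro x
    rw [hc]
    split_ifs <;> omega
  refine ⟨c, ?_, ?_⟩
  · have hm : maxEntry c ≤ maxEntry b := Finset.sup_le fun x _ =>
      (hle x).trans (Finset.le_sup (f := fun j => (b j : ℕ)) (Finset.mem_univ (ρ x)))
    have hS : sumEntries c < sumEntries b := by
      unfold sumEntries
      rw [← Equiv.sum_comp ρ fun j => (b j : ℕ)]
      let x : Fin (k - 1) := ⟨k - 2, by omega⟩
      have hx : (x : ℕ) = k - 2 := rfl
      refine Finset.sum_lt_sum (fun x _ => hle x) ⟨x, Finset.mem_univ _, ?_⟩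
      have h1 := hρ x
      rw [if_pos (by omega)] at h1
      have h2 : ρ x = j := Fin.ext (by omega)
      rw [hc, if_pos (by omega), h2]
      omega
    rcases hm.lt_or_eq with h | h
    · exact Or.inl h
    · exact Or.inr (Or.inl ⟨h, hS⟩)
  · intro t ht htj
    -- Positions shift by one, and the last entry b_1 - 1 is always raised back to b_1, which vertex
    -- t ≥ 1 of F(b) leaves unraised.
    refine mem_seqFacet.2 ⟨t - 1, by omega, ?_⟩
    refine seqVert_congr (by omega) ht ρ.symm fun y => ?_
    obtain ⟨x, rfl⟩ := ρ.surjective y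
    rw [Equiv.symm_apply_apply]
    have h1 := hρ x
    simp only [incr, hc]
    by_cases hx : (x : ℕ) + 1 = k - 1
    · rw [if_pos hx] at h1
      have h2 : ρ x = j := Fin.ext (by omega)
      rw [if_pos hx, h2, if_pos (by omega), if_neg (by omega)]
      omega
    · rw [if_neg hx] at h1
      rw [if_neg hx]
      congr 1
      refine if_congr ?_ rfl rfl
      omega

/-- Swapping the two entries at an ascent gives an earlier facet that contains all vertices of
`F(b)` but one. -/
theorem exists_precedes_of_lt (b : Seq k q) (i j : Fin (k - 1)) (hij : (i : ℕ) + 1 = j)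
    (hb : b i < b j) :
    ∃ c : Seq k q, Precedes c b ∧ ∀ t < k, t ≠ j → seqVert b (k - t) ∈ seqFacet c := by
  have hne : i ≠ j := fun h => by rw [h] at hij; omega
  refine ⟨b ∘ Equiv.swap i j, ?_, ?_⟩
  · refine Or.inr (Or.inr ⟨?_, ?_, i, ?_, ?_⟩)
    · refine le_antisymm (Finset.sup_le fun x _ => ?_) (Finset.sup_le fun x _ => ?_)
      · exact Finset.le_sup (f := fun j => (b j : ℕ)) (Finset.mem_univ (Equiv.swap i j x))
      · have := Finset.le_sup (f := fun l => ((b ∘ Equiv.swap i j) l : ℕ))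
          (Finset.mem_univ (Equiv.swap i j x))
        simp only [Function.comp, Equiv.swap_apply_self] at this
        exact this
    · exact Equiv.sum_comp (Equiv.swap i j) fun l => (b l : ℕ)
    · simpa using hb
    · intro l hl
      have h1 : l ≠ i := hl.ne
      have h2 : l ≠ j := fun h => by rw [h, Fin.lt_def] at hl; omega
      simp [Equiv.swap_apply_of_ne_of_ne h1 h2]
  · intro t ht htj
    -- For t ≠ i + 1, positions i and i + 1 are both raised or both not, so the swap keeps the
    -- multiset.
    refine mem_seqFacet.2 ⟨t, ht, ?_⟩
    refine seqVert_congr ht ht (Equiv.swap i j) fun y => ?_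
    simp only [incr, Function.comp, Equiv.swap_apply_self]
    congr 1
    refine if_congr ?_ rfl rfl
    by_cases h1 : y = i
    · rw [h1, Equiv.swap_apply_left]; omega
    by_cases h2 : y = j
    · rw [h2, Equiv.swap_apply_right]; omega
    rw [Equiv.swap_apply_of_ne_of_ne h1 h2]

theorem exists_precedes_of_mem_ascents {b : Seq k q} {j : Fin (k - 1)} (hj : j ∈ ascents b) :
    ∃ c : Seq k q, Precedes c b ∧ seqFacet b \ {seqVert b (k - j)} ⊆ seqFacet c := by
  have : ∃ c : Seq k q, Precedes c b ∧ ∀ t < k, t ≠ j → seqVert b (k - t) ∈ seqFacet c := by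
    by_cases h0 : (j : ℕ) = 0
    · exact exists_precedes_of_zero b j h0 (pos_of_mem_ascents hj)
    · have hi : (j : ℕ) - 1 + 1 = j := by omega
      exact exists_precedes_of_lt b ⟨j - 1, by omega⟩ j hi ((mem_ascents.1 hj).2 _ hi)
  obtain ⟨c, hc, h⟩ := this
  refine ⟨c, hc, fun x hx => ?_⟩
  rw [Finset.mem_sdiff, Finset.mem_singleton, mem_seqFacet] at hx
  obtain ⟨⟨t, ht, rfl⟩, hne⟩ := hx
  exact h t ht fun h => hne (by rw [h])

/-! ### Earlier facets miss an ascent vertex -/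

/-- The zeros of the vertex of `F(b)` belonging to the first ascent force the sum of `a` to be at
least that of `b`. -/
theorem sumEntries_le_of_seqVert_eq {a b : Seq k q} {j : Fin (k - 1)} {t : ℕ} (ht : t < k)
    (hj : ∀ l < j, (b l : ℕ) = 0) (h : seqVert b (k - j) = seqVert a (k - t)) :
    sumEntries b ≤ sumEntries a := by
  have hS := add_sumEntries_eq ht (by omega) h
  have hsum := sum_incr_eq_of_seqVert_eq ht (by omega) h fun x => if x = 0 then 1 else 0
  have h1 : ((j : ℕ) : ℕ) ≤ ∑ l, if incr b j l = 0 then 1 else 0 := by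
    rw [← Finset.card_filter]
    have hcard : (Finset.univ.filter fun l : Fin (k - 1) => (l : ℕ) < j).card = j := by
      rw [Fin.card_filter_val_lt]; omega
    rw [← hcard]
    refine Finset.card_le_card fun l hl => ?_
    rw [Finset.mem_filter] at hl ⊢
    rw [hcard] at *
    refine ⟨hl.1, ?_⟩
    rw [incr, hj l hl.2, if_neg (by omega)]
  have h2 : (∑ l, if incr a t l = 0 then 1 else 0) ≤ t := by
    rw [← Finset.card_filter]
    have hcard : (Finset.univ.filter fun l : Fin (k - 1) => (l : ℕ) < t).card = t := by
      rw [Fin.card_filter_val_lt]; omega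
    refine (Finset.card_le_card fun l hl => ?_).trans hcard.le
    rw [Finset.mem_filter] at hl ⊢
    refine ⟨hl.1, ?_⟩
    have := hl.2
    simp only [incr] at this
    split_ifs at this
    omega
  omega

/-- Suppose c = b_i < a_i. If ascents p ≤ i < p' of b satisfy b ≤ c on [i, p'), put f(x) = max(x - 1
- c, 0). The sum of f over vertex p minus that over vertex p' counts the entries above c in [p, p').
The counts for a and b agree, but the words coincide before i, b has no such entry from i on, and a
has a_i. Without p or p', at most one vertex is needed. -/
theorem not_lt_of_sum_incr_eq {a b : Seq k q}
    (h : ∀ j ∈ ascents b, ∀ f : ℕ → ℕ, ∑ l, f (incr b j l) = ∑ l, f (incr a j l))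
    (hS : sumEntries a = sumEntries b) (i : Fin (k - 1)) (hpre : ∀ l < i, a l = b l) :
    ¬ b i < a i := by
  intro hi
  have hi' : (b i : ℕ) < a i := hi
  rcases exists_last_ascent b i with ⟨p, hp, hpi, -⟩ | hnone
  · rcases exists_next_ascent b i with ⟨p', hp', hip', hle⟩ | hle
    · have e1 := h p hp fun x => x - 1 - b i
      have e2 := h p' hp' fun x => x - b i
      have e3 := h p' hp' fun x => if (b i : ℕ) + 1 ≤ x then 1 else 0
      have hlt : ∑ l, ((incr a p' l - b i) + ((incr b p l - 1 - b i) +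
            if (b i : ℕ) + 1 ≤ incr b p' l then 1 else 0)) <
          ∑ l, ((incr b p' l - b i) + ((incr a p l - 1 - b i) +
            if (b i : ℕ) + 1 ≤ incr a p' l then 1 else 0)) := by
        refine Finset.sum_lt_sum (fun l _ => ?_) ⟨i, Finset.mem_univ _, ?_⟩
        · rcases lt_or_ge l i with hl | hl
          · rw [incr_congr p (hpre l hl), incr_congr p' (hpre l hl)]
          · have hpl : (p : ℕ) ≤ l := Fin.le_def.1 (hpi.trans hl)
            rw [incr_of_le a hpl, incr_of_le b hpl]
            rcases lt_or_ge l p' with hl' | hl'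
            · have h1 : (b l : ℕ) ≤ b i := hle l hl hl'
              rw [incr_of_lt a hl', incr_of_lt b hl']
              split_ifs <;> omega
            · rw [incr_of_le a hl', incr_of_le b hl']
              split_ifs <;> omega
        · rw [incr_of_le a hpi, incr_of_le b hpi, incr_of_lt a hip', incr_of_lt b hip']
          split_ifs <;> omega
      simp only [Finset.sum_add_distrib] at hlt
      omega
    -- From i on, b stays at most b_i, so raised entries miss b_i + 2, which a_i + 1 reaches.
    · have e1 := h p hp fun x => if (b i : ℕ) + 2 ≤ x then 1 else 0
      refine absurd e1 (ne_of_lt (Finset.sum_lt_sum (fun l _ => ?_) ⟨i, Finset.mem_univ _, ?_⟩))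
      · rcases lt_or_ge l i with hl | hl
        · rw [incr_congr p (hpre l hl)]
        · have h1 : (b l : ℕ) ≤ b i := hle l hl
          rw [incr_of_le a (hpi.trans hl), incr_of_le b (hpi.trans hl)]
          split_ifs <;> omega
      · rw [incr_of_le a hpi, incr_of_le b hpi]
        split_ifs <;> omega
  · by_cases hne : (ascents b).Nonempty
    · obtain ⟨j, hj, hz⟩ := exists_first_ascent hne
      have hij : i < j := not_le.1 fun hji => hnone j hji hj
      have e := h j hj fun x => if x = 0 then 1 else 0
      refine absurd e (ne_of_gt (Finset.sum_lt_sum (fun l _ => ?_) ⟨i, Finset.mem_univ _, ?_⟩))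
      · rcases lt_or_ge l j with hl | hl
        · have := hz l hl
          rw [incr_of_lt a hl, incr_of_lt b hl]
          split_ifs <;> omega
        · rw [incr_of_le a hl, incr_of_le b hl]
          split_ifs <;> omega
      · have := hz i hij
        rw [incr_of_lt a hij, incr_of_lt b hij]
        split_ifs <;> omega
    · have hb : sumEntries b = 0 := Finset.sum_eq_zero fun l _ =>
        eq_zero_of_forall_notMem_ascents fun p _ hp => hne ⟨p, hp⟩
      have ha : (a i : ℕ) = 0 :=
        Finset.sum_eq_zero_iff.1 (hS.trans hb) i (Finset.mem_univ _)
      omega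

/-- A facet preceding `F(b)` misses a vertex of `F(b)` belonging to an ascent of `b`. -/
theorem exists_ascent_notMem {a b : Seq k q} (hab : Precedes a b) :
    ∃ j ∈ ascents b, seqVert b (k - j) ∉ seqFacet a := by
  by_contra! hcon
  have hS : ¬ sumEntries a < sumEntries b := by
    by_cases hne : (ascents b).Nonempty
    · obtain ⟨j, hj, hz⟩ := exists_first_ascent hne
      obtain ⟨t, ht, h⟩ := mem_seqFacet.1 (hcon j hj)
      exact not_lt.2 (sumEntries_le_of_seqVert_eq ht hz h)
    · have hb : sumEntries b = 0 := Finset.sum_eq_zero fun l _ =>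
        eq_zero_of_forall_notMem_ascents fun p _ hp => hne ⟨p, hp⟩
      omega
  rcases hab with hm | ⟨-, h⟩ | ⟨-, hSeq, i, hi, hpre⟩
  · obtain ⟨i, -, hi⟩ := (Finset.lt_sup_iff (f := fun j => (b j : ℕ))).1 hm
    rcases exists_last_ascent b i with ⟨p, hp, -, hle⟩ | hnone
    · obtain ⟨t, ht, h⟩ := mem_seqFacet.1 (hcon p hp)
      -- The ascent vertex has the entry b_p + 1 ≥ m(a) + 2, while raised entries of a are at most
      -- m(a) + 1.
      have hsum := sum_incr_eq_of_seqVert_eq ht (by omega) h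
        fun x => if maxEntry a + 2 ≤ x then 1 else 0
      have h0 : (∑ l, if maxEntry a + 2 ≤ incr a t l then 1 else 0) = 0 := by
        refine Finset.sum_eq_zero fun l _ => if_neg ?_
        have : (a l : ℕ) ≤ maxEntry a :=
          Finset.le_sup (f := fun j => (a j : ℕ)) (Finset.mem_univ l)
        simp only [incr]
        split_ifs <;> omega
      rw [h0] at hsum
      have := Finset.sum_eq_zero_iff.1 hsum p (Finset.mem_univ _)
      have hle' : (b i : ℕ) ≤ b p := hle
      simp only [incr, if_pos le_rfl] at this
      split_ifs at this
      omega
    · have := eq_zero_of_forall_notMem_ascents hnone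
      omega
  · exact hS h
  · refine not_lt_of_sum_incr_eq (fun j hj f => ?_) hSeq i hpre hi
    obtain ⟨t, ht, h⟩ := mem_seqFacet.1 (hcon j hj)
    have h1 := add_sumEntries_eq ht (by omega) h
    have h2 : t = j := by omega
    rw [h2] at h ht
    exact sum_incr_eq_of_seqVert_eq ht ht h f

/-! ### Restrictions, shelling and h-vector of the subdivision -/

/-- An earlier facet containing F(a) minus x misses an ascent vertex, which must be x. -/
theorem restriction_seqFacet (a : Seq k q) :
    restriction seqFacet Precedes a = {x | ∃ j ∈ ascents a, x = seqVert a (k - (j : ℕ))} := by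
  ext x
  constructor
  · rintro ⟨hx, b, hb, hsub⟩
    obtain ⟨j, hj, hnot⟩ := exists_ascent_notMem hb
    refine ⟨j, hj, ?_⟩
    by_contra hne
    refine hnot (hsub (Finset.mem_sdiff.2 ⟨mem_seqFacet.2 ⟨j, by omega, rfl⟩, ?_⟩))
    rw [Finset.mem_singleton]
    exact fun h => hne h.symm
  · rintro ⟨j, hj, rfl⟩
    exact ⟨mem_seqFacet.2 ⟨j, by omega, rfl⟩, exists_precedes_of_mem_ascents hj⟩

theorem isShellingOrder_T (hk : 1 ≤ k) :
    IsShellingOrder (T k q) (seqFacet : Seq k q → Finset (Fin (k - 1) → ℤ)) Precedes where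
  pure := isPure_T hk
  finite := inferInstance
  bijOn := by
    refine ⟨fun a _ => (isFacet_T_iff hk).2 ⟨a, rfl⟩, (seqFacet_injective hk).injOn, ?_⟩
    intro s hs
    obtain ⟨a, rfl⟩ := (isFacet_T_iff hk).1 hs
    exact ⟨a, Set.mem_univ a, rfl⟩
  irrefl := precedes_irrefl
  trans _ _ _ := precedes_trans
  total := precedes_total
  shell a b hab := by
    obtain ⟨j, hj, hnot⟩ := exists_ascent_notMem hab
    obtain ⟨c, hc, hsub⟩ := exists_precedes_of_mem_ascents hj
    have hmem : seqVert b (k - j) ∈ seqFacet b := mem_seqFacet.2 ⟨j, by omega, rfl⟩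
    -- F(c) contains k - 1 vertices of F(b) and is a different facet, so it contains no more.
    have heq : seqFacet c ∩ seqFacet b = seqFacet b \ {seqVert b (k - j)} := by
      refine (Finset.eq_of_subset_of_card_le
        (Finset.subset_inter hsub Finset.sdiff_subset) ?_).symm
      rw [Finset.card_sdiff_of_subset (Finset.singleton_subset_iff.2 hmem), card_seqFacet,
        Finset.card_singleton]
      have hlt : (seqFacet c ∩ seqFacet b).card < (seqFacet b).card := by
        refine Finset.card_lt_card (Finset.ssubset_iff_subset_ne.2
          ⟨Finset.inter_subset_right, fun h => ?_⟩)
        have h1 := Finset.eq_of_subset_of_card_le (Finset.inter_eq_right.1 h)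
          (by rw [card_seqFacet, card_seqFacet])
        rw [seqFacet_injective hk h1] at hc
        exact precedes_irrefl c hc
      rw [card_seqFacet] at hlt
      omega
    refine ⟨c, hc, _, hmem, ?_, heq⟩
    rw [heq]
    intro x hx
    rw [Finset.mem_inter] at hx
    refine Finset.mem_sdiff.2 ⟨hx.2, ?_⟩
    rw [Finset.mem_singleton]
    rintro rfl
    exact hnot hx.1

theorem hVector_T (hk : 1 ≤ k) (hq : 1 ≤ q) {i : ℕ} (hi : i ≤ k) :
    hVector (T k q) i =
      ((Finset.univ.filter fun a : Seq k q => (ascents a).card = i).card : ℤ) := by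
  -- Some facet must exist for the empty face to lie in an interval.
  have : Nonempty (Seq k q) := ⟨fun _ => ⟨0, hq⟩⟩
  rw [(isShellingOrder_T hk).hVector_eq (fun _ => mem_faces_T) hk card_seqFacet
    (fun a => (ascents a).image fun j : Fin (k - 1) => seqVert a (k - (j : ℕ))) ?_ hi]
  · congr 3
    funext a
    rw [Finset.card_image_of_injOn]
    intro j _ l _ h
    exact (Fin.ext (seqVert_injOn a (by omega) (by omega) h)).symm
  · intro a
    rw [restriction_seqFacet]
    ext x
    simp [eq_comm]

end Ascents

end Edgewise

/-- For `k, q ≥ 1`: the order `Precedes` is a shelling order of the facets `F(a)` of `T_{k,q}`;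
the restriction of `F(a)` is `{v_a^{(k+1-i)} : 1 ≤ i ≤ k-1, a_{i-1} < a_i}` with `a_0 = 0`
(here `i = j + 1`, so `k + 1 - i = k - j`); and `h_i(T_{k,q})`, `0 ≤ i ≤ k`, is the number of
sequences `(0, a_1, …, a_{k-1})` with exactly `i` ascents. -/
theorem mainTheorem3 (k q : ℕ) (hk : 1 ≤ k) (hq : 1 ≤ q) :
    Edgewise.IsShellingOrder (Edgewise.T k q)
      (Edgewise.seqFacet : Edgewise.Seq k q → Finset (Fin (k - 1) → ℤ)) Edgewise.Precedes ∧
    (∀ a : Edgewise.Seq k q,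
      Edgewise.restriction Edgewise.seqFacet Edgewise.Precedes a =
        {x | ∃ j ∈ Edgewise.ascents a, x = Edgewise.seqVert a (k - (j : ℕ))}) ∧
    (∀ i : ℕ, i ≤ k →
      Edgewise.hVector (Edgewise.T k q) i =
        (((Finset.univ : Finset (Edgewise.Seq k q)).filter
          fun a => (Edgewise.ascents a).card = i).card : ℤ)) := by
  exact ⟨Edgewise.isShellingOrder_T hk, Edgewise.restriction_seqFacet,
    fun i hi => Edgewise.hVector_T hk hq hi⟩
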